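/- Let $n\ge 1$, $X\in\mathbb R^{n\times d}$, $w^*\in\mathbb R^d$, and put $K=XX^\top/n$ and $y=Xw^*\in\mathbb R^n$; assume $y\neq 0$. For a symmetric $n\times n$ matrix $A$ let $\lambda_1^A\ge\dots\ge\lambda_n^A$ be its eigenvalues. Assume that $\lambda_i^K=e^{-(i-1)c}$ for $i=1,\dots,n$, with some $c>0$, and for real $s$ write $\lambda_s^K=e^{-(s-1)c}$. Let $0<\alpha<1/\lambda_1^K$, $\sigma_w\in\mathbb R$, let $T\ge1$ be an integer, $K_d=I-\alpha K$, and \[ P_1(T)=P_1^{\sigma_w}(T)+P_1^y(T),\qquad P_1^{\sigma_w}(T)=\frac{\sigma_w^2}{T}\sum_{t=0}^{T-1}K_d^{2t}K,\qquad P_1^{y}(T)=\frac1T\sum_{t=0}^{T-1}K_d^t\,yy^\top K_d^t . \] Put \[ \rho=\exp\left(\frac{\pi^2}{2\ln\left(8\lambda_1^K/\lambda_n^K-4\right)}\right),\qquad k^*=\min\left\{\frac{\ln(2T\alpha)}{2c},\frac n2\right\}\in\mathbb R . \] Then for all $i=1,\dots,n$ the eigenvalues $\lambda_i=\lambda_i^{P_1(T)}$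 satisfy \[ \frac{\lambda_i}{\lambda_1}\le\min\left\{1,\;4\rho^{-(i-1)}+\frac{\sigma_w^2}{\alpha\|y\|^2}\right\}\quad\text{if } i\le 2k^*, \] \[ \frac{\lambda_i}{\lambda_1}\le 4\rho^{-(k^*-1)}+\frac{\sigma_w^2}{\alpha\|y\|^2}\,\min\left\{1,\;2\alpha T\lambda^K_{i-k^*+1}\right\}\quad\text{if } i> 2k^* . \] -/

import Mathlib

open Matrix

noncomputable section

namespace Sloppy

/-- The `i`-th largest eigenvalue (`i = 1, …, n`, with multiplicity) of a real symmetric matrix. -/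
def eig {n : ℕ} {A : Matrix (Fin n) (Fin n) ℝ} (hA : A.IsHermitian) (i : ℕ)
    (hi : 1 ≤ i ∧ i ≤ n) : ℝ :=
  hA.eigenvalues₀ ⟨i - 1, by rw [Fintype.card_fin]; omega⟩

/-- The input-correlation matrix `K = X Xᵀ / n`; the rows of `X` are the inputs. -/
def kernel {n d : ℕ} (X : Matrix (Fin n) (Fin d) ℝ) : Matrix (Fin n) (Fin n) ℝ :=
  (1 / (n : ℝ)) • (X * Xᵀ)

/-- The vector of targets `y_i = ⟪w*, x_i⟫`. -/
def target {n d : ℕ} (X : Matrix (Fin n) (Fin d) ℝ) (wstar : Fin d → ℝ) : Fin n → ℝ :=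
  X *ᵥ wstar

/-- One step of gradient descent on the residuals, `K_d = I - α K`. -/
def stepMatrix {n : ℕ} (α : ℝ) (K : Matrix (Fin n) (Fin n) ℝ) : Matrix (Fin n) (Fin n) ℝ :=
  1 - α • K

/-- `P₁^{σ_w}(T) = (σ_w² / T) ∑_{t < T} K_d^{2t} K`. -/
def P1Init {n : ℕ} (α σw : ℝ) (T : ℕ) (K : Matrix (Fin n) (Fin n) ℝ) :
    Matrix (Fin n) (Fin n) ℝ :=
  (σw ^ 2 / (T : ℝ)) • ∑ t ∈ Finset.range T, stepMatrix α K ^ (2 * t) * K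

/-- `P₁^y(T) = (1 / T) ∑_{t < T} K_d^t y yᵀ K_d^t`. -/
def P1Target {n : ℕ} (α : ℝ) (T : ℕ) (K : Matrix (Fin n) (Fin n) ℝ) (y : Fin n → ℝ) :
    Matrix (Fin n) (Fin n) ℝ :=
  (1 / (T : ℝ)) • ∑ t ∈ Finset.range T,
    stepMatrix α K ^ t * vecMulVec y y * stepMatrix α K ^ t

/-- `P₁(T) = P₁^{σ_w}(T) + P₁^y(T)`. -/
def P1 {n : ℕ} (α σw : ℝ) (T : ℕ) (K : Matrix (Fin n) (Fin n) ℝ) (y : Fin n → ℝ) :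
    Matrix (Fin n) (Fin n) ℝ :=
  P1Init α σw T K + P1Target α T K y

/-- The sloppy spectrum `s ↦ exp (-(s - 1) c)`, as a function of a real index `s`. -/
def sloppy (c s : ℝ) : ℝ := Real.exp (-(s - 1) * c)

/-- `ρ = exp (π² / (2 ln (8 λ₁ / λ_n - 4)))`. -/
def rho (l1 ln : ℝ) : ℝ :=
  Real.exp (Real.pi ^ 2 / (2 * Real.log (8 * l1 / ln - 4)))

/-- `k* = min {ln (2 T α) / (2 c), n / 2}`, a real number. -/
def kstar (n T : ℕ) (α c : ℝ) : ℝ :=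
  min (Real.log (2 * (T : ℝ) * α) / (2 * c)) ((n : ℝ) / 2)

theorem kernel_isHermitian {n d : ℕ} (X : Matrix (Fin n) (Fin d) ℝ) :
    (kernel X).IsHermitian := by
  unfold kernel Matrix.IsHermitian
  rw [conjTranspose_eq_transpose_of_trivial, transpose_smul, transpose_mul, transpose_transpose]

theorem stepMatrix_isHermitian {n : ℕ} (α : ℝ) {K : Matrix (Fin n) (Fin n) ℝ}
    (hK : K.IsHermitian) : (stepMatrix α K).IsHermitian := by
  unfold stepMatrix
  refine isHermitian_one.sub ?_
  unfold Matrix.IsHermitian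
  rw [conjTranspose_smul, hK.eq, star_trivial]

theorem P1_isHermitian {n : ℕ} (α σw : ℝ) (T : ℕ) {K : Matrix (Fin n) (Fin n) ℝ}
    (hK : K.IsHermitian) (y : Fin n → ℝ) : (P1 α σw T K y).IsHermitian := by
  have hD := stepMatrix_isHermitian α hK
  have hc : Commute (stepMatrix α K) K :=
    (Commute.one_left K).sub_left ((Commute.refl K).smul_left α)
  unfold P1 P1Init P1Target
  refine IsHermitian.add ?_ ?_
  · unfold Matrix.IsHermitian
    rw [conjTranspose_smul, star_trivial, conjTranspose_sum]
    congr 1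
    refine Finset.sum_congr rfl fun t _ => ?_
    rw [conjTranspose_mul, conjTranspose_pow, hD.eq, hK.eq]
    exact ((hc.pow_left (2 * t)).eq).symm
  · unfold Matrix.IsHermitian
    rw [conjTranspose_smul, star_trivial, conjTranspose_sum]
    congr 1
    refine Finset.sum_congr rfl fun t _ => ?_
    rw [conjTranspose_mul, conjTranspose_mul, conjTranspose_pow, hD.eq,
      conjTranspose_vecMulVec, star_trivial, Matrix.mul_assoc]

end Sloppy

end

/-! In an eigenbasis of `K` the quadratic form of `P₁` splits into a diagonal part, coming from
`σ_w`, and `1 / T` times the Krylov form `∑ₜ ⟨y, κᵗ x⟩²` with `κ = 1 - α μ`. The Krylov form has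
displacement structure: for `p > 0`, on a suitable hyperplane, it does not decrease when `x` is
multiplied by `(s - p) / (s + p)`, where `s = (1 - κ) / (1 + κ)` (`krylovForm_le_of_sum_eq_zero`).
Hence, on a subspace whose codimension is at most the number of zeros, it is at most its value at
`B(s) x`, with `B` a product of such factors. That value, divided by `T`, is at most `λ₁ ‖B(s) x‖²`,
so a `B` that is small on the spectrum makes the later eigenvalues of `P₁` small compared with `λ₁`.
Removing also the first `m` eigenvectors of `K` reduces the diagonal part; Courant-Fischer combines
both effects (`eig_P1_le`).

A good `B` of degree `2 ^ m` comes from Zolotarev's problem. On `[θ₄², θ₃²]` a Landen (AGM) step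
doubles both the degree and the logarithm `A` of the inverse nome, giving `|B| ≤ 2 exp (-2 ^ m A)`;
modularity relates `A` to the ratio of the endpoints (`exists_blaschke_le_theta`,
`exists_blaschke_sq_le`). Squaring `B` puts twice the degree in the exponent, which pays for
rounding the degree down to a power of two.

Finally `λ₁ ≥ ‖y‖² / T` (`le_eig_one_P1`) turns bounds on the diagonal part into the terms with
`σ_w² / (α ‖y‖²)`. -/

noncomputable section

namespace Sloppy

/-! ### Theta constants as functions of the logarithm `A` of the inverse nome -/

/-- `θ₂ = ∑ exp (-A (n + 1/2)²)`. -/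
def thetaTwo (A : ℝ) : ℝ := ∑' n : ℤ, Real.exp (-A * ((n : ℝ) + 1 / 2) ^ 2)

/-- `θ₃ = ∑ exp (-A n²)`. -/
def thetaThree (A : ℝ) : ℝ := ∑' n : ℤ, Real.exp (-A * (n : ℝ) ^ 2)

/-- `θ₄ = ∑ (-1)ⁿ exp (-A n²)`. -/
def thetaFour (A : ℝ) : ℝ := ∑' n : ℤ, (-1 : ℝ) ^ n * Real.exp (-A * (n : ℝ) ^ 2)

theorem summable_thetaTwo {A : ℝ} (hA : 0 < A) :
    Summable fun n : ℤ => Real.exp (-A * ((n : ℝ) + 1 / 2) ^ 2) := by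
  have h := summable_pow_mul_jacobiTheta₂_term_bound (A / (2 * Real.pi)) (T := A / Real.pi)
    (by positivity) 0
  refine Summable.of_nonneg_of_le (fun _ => (Real.exp_pos _).le) (fun n => ?_) h
  rw [pow_zero, one_mul, Real.exp_le_exp]
  have e : -Real.pi * (A / Real.pi * (n : ℝ) ^ 2 - 2 * (A / (2 * Real.pi)) * |(n : ℝ)|) =
      -A * ((n : ℝ) ^ 2 - |(n : ℝ)|) := by
    field_simp
  push_cast
  rw [e]
  have := neg_abs_le (n : ℝ)
  nlinarith

theorem summable_thetaThree {A : ℝ} (hA : 0 < A) :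
    Summable fun n : ℤ => Real.exp (-A * (n : ℝ) ^ 2) := by
  have h := summable_pow_mul_jacobiTheta₂_term_bound 0 (T := A / Real.pi) (by positivity) 0
  refine h.congr fun n => ?_
  rw [pow_zero, one_mul]
  congr 1
  field_simp
  simp

theorem summable_thetaFour {A : ℝ} (hA : 0 < A) :
    Summable fun n : ℤ => (-1 : ℝ) ^ n * Real.exp (-A * (n : ℝ) ^ 2) := by
  refine Summable.of_norm ((summable_thetaThree hA).congr fun n => ?_)
  simp

theorem thetaThree_pos {A : ℝ} (hA : 0 < A) : 0 < thetaThree A :=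
  (summable_thetaThree hA).tsum_pos (fun _ => (Real.exp_pos _).le) 0 (Real.exp_pos _)

theorem thetaTwo_pos {A : ℝ} (hA : 0 < A) : 0 < thetaTwo A :=
  (summable_thetaTwo hA).tsum_pos (fun _ => (Real.exp_pos _).le) 0 (Real.exp_pos _)

/-- The terms at `n` and `-n - 1` agree, and `(n + 1/2)² ≥ n² + 1/4` for `n ≥ 0`. -/
theorem thetaTwo_le {A : ℝ} (hA : 0 < A) :
    thetaTwo A ≤ 2 * Real.exp (-A / 4) * thetaThree A := by
  have inj : Function.Injective (fun n : ℕ => (n : ℤ)) := Nat.cast_injective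
  have inj' : Function.Injective (fun n : ℕ => -((n : ℤ) + 1)) := fun a b h => by
    simp only at h; omega
  have hs := summable_thetaTwo hA
  have hs3 := summable_thetaThree hA
  have h1 : thetaTwo A = 2 * ∑' n : ℕ, Real.exp (-A * ((n : ℝ) + 1 / 2) ^ 2) := by
    have h := tsum_of_nat_of_neg_add_one (f := fun n : ℤ => Real.exp (-A * ((n : ℝ) + 1 / 2) ^ 2))
      (hs.comp_injective inj) (hs.comp_injective inj')
    have e : ∀ n : ℕ, Real.exp (-A * (((-((n : ℤ) + 1) : ℤ) : ℝ) + 1 / 2) ^ 2) =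
        Real.exp (-A * ((n : ℝ) + 1 / 2) ^ 2) := by
      intro n
      congr 1
      push_cast
      ring
    simp only [e, Int.cast_natCast] at h
    rw [thetaTwo, h, two_mul]
  have h2 : ∑' n : ℕ, Real.exp (-A * (n : ℝ) ^ 2) ≤ thetaThree A := by
    have := tsum_comp_le_tsum_of_inj hs3 (fun _ => (Real.exp_pos _).le) inj
    simpa [Function.comp_def, thetaThree] using this
  have hs3n : Summable fun n : ℕ => Real.exp (-A * (n : ℝ) ^ 2) := by
    simpa [Function.comp_def] using hs3.comp_injective inj
  have h3 : ∑' n : ℕ, Real.exp (-A * ((n : ℝ) + 1 / 2) ^ 2) ≤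
      Real.exp (-A / 4) * ∑' n : ℕ, Real.exp (-A * (n : ℝ) ^ 2) := by
    rw [← tsum_mul_left]
    refine Summable.tsum_le_tsum (fun n => ?_) ?_ (hs3n.mul_left _)
    · rw [← Real.exp_add, Real.exp_le_exp]
      have : (0 : ℝ) ≤ n := n.cast_nonneg
      nlinarith [mul_nonneg hA.le this]
    · simpa [Function.comp_def] using hs.comp_injective inj
  have := Real.exp_pos (-A / 4)
  nlinarith

/-- The sum keeps only the even indices, the difference only the odd ones. -/
theorem theta_quadruplication {A : ℝ} (hA : 0 < A) :
    thetaThree A + thetaFour A = 2 * thetaThree (4 * A) ∧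
      thetaThree A - thetaFour A = 2 * thetaTwo (4 * A) := by
  constructor
  · unfold thetaThree thetaFour
    rw [← (summable_thetaThree hA).tsum_add (summable_thetaFour hA), ← tsum_mul_left]
    have inj : Function.Injective (fun n : ℤ => 2 * n) := fun a b h => by
      simp only at h; omega
    rw [← inj.tsum_eq]
    · refine tsum_congr fun n => ?_
      rw [(even_two_mul n).neg_one_zpow, one_mul, ← two_mul]
      congr 2
      push_cast
      ring
    · intro n hn
      by_contra hne
      have hodd : Odd n := by
        rw [← Int.not_even_iff_odd]
        rintro ⟨m, rfl⟩
        exact hne ⟨m, by simp only; ring⟩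
      exact hn (by simp [hodd.neg_one_zpow])
  · unfold thetaThree thetaFour thetaTwo
    rw [← (summable_thetaThree hA).tsum_sub (summable_thetaFour hA), ← tsum_mul_left]
    have inj : Function.Injective (fun n : ℤ => 2 * n + 1) := fun a b h => by
      simp only at h; omega
    rw [← inj.tsum_eq]
    · refine tsum_congr fun n => ?_
      rw [(odd_two_mul_add_one n).neg_one_zpow, neg_one_mul, sub_neg_eq_add, ← two_mul]
      congr 2
      push_cast
      ring
    · intro n hn
      by_contra hne
      have heven : Even n := by
        rw [← Int.not_odd_iff_even]
        rintro ⟨m, rfl⟩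
        exact hne ⟨m, rfl⟩
      exact hn (by simp [heven.neg_one_zpow])

theorem thetaThree_modular {A : ℝ} (hA : 0 < A) :
    thetaThree A = 1 / (A / Real.pi) ^ (1 / 2 : ℝ) * thetaThree (Real.pi ^ 2 / A) := by
  have h := Real.tsum_exp_neg_mul_int_sq (a := A / Real.pi) (by positivity)
  have e1 : -Real.pi * (A / Real.pi) = -A := by field_simp
  have e2 : -Real.pi / (A / Real.pi) = -(Real.pi ^ 2 / A) := by field_simp
  rwa [e1, e2] at h

/-- Poisson summation: the sign `(-1)ⁿ` is a character, which becomes a half-integer shift on the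
dual side. -/
theorem thetaFour_modular {A : ℝ} (hA : 0 < A) :
    thetaFour A = 1 / (A / Real.pi) ^ (1 / 2 : ℝ) * thetaTwo (Real.pi ^ 2 / A) := by
  have hpi := Real.pi_pos
  have hre : 0 < ((A / Real.pi : ℝ) : ℂ).re := by
    rw [Complex.ofReal_re]; positivity
  have h := Complex.tsum_exp_neg_quadratic hre (Complex.I / 2)
  have hl : ∀ n : ℤ, Complex.exp (-Real.pi * ((A / Real.pi : ℝ) : ℂ) * n ^ 2 +
      2 * Real.pi * (Complex.I / 2) * n) =
      (((-1 : ℝ) ^ n * Real.exp (-A * (n : ℝ) ^ 2) : ℝ) : ℂ) := by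
    intro n
    have e : -Real.pi * ((A / Real.pi : ℝ) : ℂ) * n ^ 2 + 2 * Real.pi * (Complex.I / 2) * n =
        n * (Real.pi * Complex.I) + ((-A * (n : ℝ) ^ 2 : ℝ) : ℂ) := by
      have : (Real.pi : ℂ) ≠ 0 := by exact_mod_cast hpi.ne'
      push_cast
      field_simp
      ring
    rw [e, Complex.exp_add, Complex.exp_int_mul, Complex.exp_pi_mul_I]
    push_cast
    rfl
  have hr : ∀ n : ℤ, Complex.exp (-Real.pi / ((A / Real.pi : ℝ) : ℂ) *
      (n + Complex.I * (Complex.I / 2)) ^ 2) =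
      ((Real.exp (-(Real.pi ^ 2 / A) * ((n : ℝ) - 1 / 2) ^ 2) : ℝ) : ℂ) := by
    intro n
    have e : -Real.pi / ((A / Real.pi : ℝ) : ℂ) * (n + Complex.I * (Complex.I / 2)) ^ 2 =
        ((-(Real.pi ^ 2 / A) * ((n : ℝ) - 1 / 2) ^ 2 : ℝ) : ℂ) := by
      have : (Real.pi : ℂ) ≠ 0 := by exact_mod_cast hpi.ne'
      have : (A : ℂ) ≠ 0 := by exact_mod_cast hA.ne'
      have : Complex.I * (Complex.I / 2) = -(1 / 2 : ℂ) := by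
        rw [← mul_div_assoc, Complex.I_mul_I]; norm_num
      rw [this]
      push_cast
      field_simp
      ring
    rw [e, Complex.ofReal_exp]
  simp_rw [hl, hr] at h
  rw [← Complex.ofReal_tsum, ← Complex.ofReal_tsum] at h
  have e3 : (1 : ℂ) / ((A / Real.pi : ℝ) : ℂ) ^ (1 / 2 : ℂ) =
      ((1 / (A / Real.pi) ^ (1 / 2 : ℝ) : ℝ) : ℂ) := by
    have h0 : (0 : ℝ) ≤ A / Real.pi := by positivity
    rw [Complex.ofReal_div 1, Complex.ofReal_cpow h0]
    norm_num
  rw [e3, ← Complex.ofReal_mul, Complex.ofReal_inj] at h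
  unfold thetaFour thetaTwo
  rw [h, ← (Equiv.addRight (1 : ℤ)).tsum_eq]
  congr 1
  refine tsum_congr fun n => ?_
  simp only [Equiv.coe_addRight]
  congr 2
  push_cast
  ring

theorem thetaFour_pos {A : ℝ} (hA : 0 < A) : 0 < thetaFour A := by
  rw [thetaFour_modular hA]
  have := thetaTwo_pos (A := Real.pi ^ 2 / A) (by positivity)
  positivity

theorem thetaFour_lt_thetaThree {A : ℝ} (hA : 0 < A) : thetaFour A < thetaThree A := by
  have := (theta_quadruplication hA).2
  have := thetaTwo_pos (A := 4 * A) (by positivity)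
  linarith

theorem thetaThree_sub_thetaFour_le {A : ℝ} (hA : 0 < A) :
    thetaThree A - thetaFour A ≤ 2 * Real.exp (-A) * (thetaThree A + thetaFour A) := by
  obtain ⟨h1, h2⟩ := theta_quadruplication hA
  have h := thetaTwo_le (A := 4 * A) (by positivity)
  have e : -(4 * A) / 4 = -A := by ring
  rw [e] at h
  rw [h1, h2]
  linarith

theorem thetaFour_le {A : ℝ} (hA : 0 < A) :
    thetaFour A ≤ 2 * Real.exp (-(Real.pi ^ 2 / A) / 4) * thetaThree A := by
  rw [thetaFour_modular hA, thetaThree_modular hA]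
  have h := thetaTwo_le (A := Real.pi ^ 2 / A) (by positivity)
  have hp : 0 ≤ 1 / (A / Real.pi) ^ (1 / 2 : ℝ) := by positivity
  calc _ ≤ 1 / (A / Real.pi) ^ (1 / 2 : ℝ) *
      (2 * Real.exp (-(Real.pi ^ 2 / A) / 4) * thetaThree (Real.pi ^ 2 / A)) :=
        mul_le_mul_of_nonneg_left h hp
    _ = _ := by ring

/-- Summation over `ℤ²` along the bijection `(u, v) ↦ (u + v, u - v)` onto the pairs of equal
parity. -/
theorem tsum_int_prod_eq_of_support {f : ℤ × ℤ → ℝ} (hf : ∀ p : ℤ × ℤ, Odd (p.1 + p.2) → f p = 0) :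
    ∑' p, f p = ∑' p : ℤ × ℤ, f (p.1 + p.2, p.1 - p.2) := by
  have inj : Function.Injective (fun p : ℤ × ℤ => (p.1 + p.2, p.1 - p.2)) := by
    rintro ⟨a, b⟩ ⟨a', b'⟩ h
    simp only [Prod.mk.injEq] at h ⊢
    omega
  refine (inj.tsum_eq fun p hp => ?_).symm
  have heven : Even (p.1 + p.2) := by
    rw [← Int.not_odd_iff_even]
    exact fun h => hp (hf p h)
  obtain ⟨u, hu⟩ := heven
  refine ⟨(u, p.1 - u), ?_⟩
  ext <;> simp only <;> omega

/-- The arithmetic-mean half of the AGM step. In the double series the pairs of odd sum cancel, and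
`(u + v)² + (u - v)² = 2 (u² + v²)` separates the remaining ones. -/
theorem thetaThree_sq_add_thetaFour_sq {A : ℝ} (hA : 0 < A) :
    thetaThree A ^ 2 + thetaFour A ^ 2 = 2 * thetaThree (2 * A) ^ 2 := by
  have s3 := summable_thetaThree hA
  have s4 := summable_thetaFour hA
  have s6 := summable_thetaThree (A := 2 * A) (by positivity)
  have p3 := summable_mul_of_summable_norm s3.norm s3.norm
  have p4 := summable_mul_of_summable_norm s4.norm s4.norm
  unfold thetaThree thetaFour
  rw [sq, sq, sq, tsum_mul_tsum_of_summable_norm s3.norm s3.norm,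
    tsum_mul_tsum_of_summable_norm s4.norm s4.norm,
    tsum_mul_tsum_of_summable_norm s6.norm s6.norm, ← p3.tsum_add p4,
    tsum_int_prod_eq_of_support, ← tsum_mul_left]
  · refine tsum_congr fun p => ?_
    have hz : (-1 : ℝ) ^ (p.1 + p.2) * (-1 : ℝ) ^ (p.1 - p.2) = 1 := by
      rw [← zpow_add₀ (by norm_num)]
      exact Even.neg_one_zpow ⟨p.1, by ring⟩
    have he : Real.exp (-A * ((p.1 + p.2 : ℤ) : ℝ) ^ 2) *
        Real.exp (-A * ((p.1 - p.2 : ℤ) : ℝ) ^ 2) =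
        Real.exp (-(2 * A) * (p.1 : ℝ) ^ 2) * Real.exp (-(2 * A) * (p.2 : ℝ) ^ 2) := by
      rw [← Real.exp_add, ← Real.exp_add]
      congr 1
      push_cast
      ring
    simp only
    rw [mul_mul_mul_comm, hz, he]
    ring
  · intro p hp
    have hz : (-1 : ℝ) ^ p.1 * (-1 : ℝ) ^ p.2 = -1 := by
      rw [← zpow_add₀ (by norm_num)]
      exact hp.neg_one_zpow
    rw [mul_mul_mul_comm, hz]
    ring

/-- The geometric-mean half of the AGM step. The product is symmetrized so that the pairs of odd sum
cancel here too. -/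
theorem thetaThree_mul_thetaFour {A : ℝ} (hA : 0 < A) :
    thetaThree A * thetaFour A = thetaFour (2 * A) ^ 2 := by
  have s3 := summable_thetaThree hA
  have s4 := summable_thetaFour hA
  have s6 := summable_thetaFour (A := 2 * A) (by positivity)
  have p3 := summable_mul_of_summable_norm s3.norm s4.norm
  have p4 := summable_mul_of_summable_norm s4.norm s3.norm
  have hsum : thetaThree A * thetaFour A + thetaFour A * thetaThree A =
      2 * thetaFour (2 * A) ^ 2 := by
    unfold thetaThree thetaFour
    rw [sq, tsum_mul_tsum_of_summable_norm s3.norm s4.norm,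
      tsum_mul_tsum_of_summable_norm s4.norm s3.norm,
      tsum_mul_tsum_of_summable_norm s6.norm s6.norm, ← p3.tsum_add p4,
      tsum_int_prod_eq_of_support, ← tsum_mul_left]
    · refine tsum_congr fun p => ?_
      have hz : (-1 : ℝ) ^ (p.1 - p.2) = (-1 : ℝ) ^ p.1 * (-1 : ℝ) ^ p.2 := by
        rw [zpow_sub₀ (by norm_num), div_eq_mul_inv, ← _root_.inv_zpow, inv_neg_one]
      have hz' : (-1 : ℝ) ^ (p.1 + p.2) = (-1 : ℝ) ^ p.1 * (-1 : ℝ) ^ p.2 :=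
        zpow_add₀ (by norm_num) _ _
      have he : Real.exp (-A * ((p.1 + p.2 : ℤ) : ℝ) ^ 2) *
          Real.exp (-A * ((p.1 - p.2 : ℤ) : ℝ) ^ 2) =
          Real.exp (-(2 * A) * (p.1 : ℝ) ^ 2) * Real.exp (-(2 * A) * (p.2 : ℝ) ^ 2) := by
        rw [← Real.exp_add, ← Real.exp_add]
        congr 1
        push_cast
        ring
      simp only
      rw [hz, hz']
      linear_combination (2 * (-1 : ℝ) ^ p.1 * (-1 : ℝ) ^ p.2) * he
    · intro p hp
      have hz : (-1 : ℝ) ^ p.1 + (-1 : ℝ) ^ p.2 = 0 := by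
        rcases Int.even_or_odd p.1 with h | h
        · have h' : Odd p.2 := (Int.odd_add'.mp hp).mpr h
          rw [h.neg_one_zpow, h'.neg_one_zpow]; norm_num
        · have h' : Even p.2 := (Int.odd_add.mp hp).mp h
          rw [h.neg_one_zpow, h'.neg_one_zpow]; norm_num
      linear_combination (Real.exp (-A * (p.1 : ℝ) ^ 2) * Real.exp (-A * (p.2 : ℝ) ^ 2)) * hz
  linarith [mul_comm (thetaThree A) (thetaFour A)]

/-! ### Rational functions small on an interval and large on its mirror image -/

/-- The value at `s` of the rational function `∏ (s - p) / (s + p)` with zeros `p ∈ l`. -/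
def blaschke (l : List ℝ) (s : ℝ) : ℝ := (l.map fun p => (s - p) / (s + p)).prod

theorem blaschke_cons (p : ℝ) (l : List ℝ) (s : ℝ) :
    blaschke (p :: l) s = (s - p) / (s + p) * blaschke l s := by
  simp [blaschke]

/-- The two solutions `x` of `(x + c / x) / 2 = p`, for each `p` of a list. -/
def landenPullback (c : ℝ) : List ℝ → List ℝ
  | [] => []
  | p :: l => (p + √(p ^ 2 - c)) :: (p - √(p ^ 2 - c)) :: landenPullback c l

theorem length_landenPullback (c : ℝ) (l : List ℝ) :
    (landenPullback c l).length = 2 * l.length := by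
  induction l with
  | nil => rfl
  | cons p l ih => simp only [landenPullback, List.length_cons, ih]; ring

theorem exists_of_mem_landenPullback {c x : ℝ} {l : List ℝ} (h : x ∈ landenPullback c l) :
    ∃ p ∈ l, x = p + √(p ^ 2 - c) ∨ x = p - √(p ^ 2 - c) := by
  induction l with
  | nil => simp [landenPullback] at h
  | cons p l ih =>
    simp only [landenPullback, List.mem_cons] at h
    rcases h with h | h | h
    · exact ⟨p, by simp, Or.inl h⟩
    · exact ⟨p, by simp, Or.inr h⟩
    · obtain ⟨p', hp', h'⟩ := ih h
      exact ⟨p', by simp [hp'], h'⟩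

/-- The two preimages of `p` are the roots of `s² - 2 p s + c`, and those of `-p` are their
negatives, so two factors upstairs make one factor downstairs. -/
theorem blaschke_landenPullback {c s : ℝ} (hc : 0 ≤ c) (hs : 0 < s) {l : List ℝ}
    (hl : ∀ p ∈ l, 0 < p ∧ c ≤ p ^ 2) :
    blaschke (landenPullback c l) s = blaschke l ((s + c / s) / 2) := by
  induction l with
  | nil => rfl
  | cons p l ih =>
    have hp := hl p (by simp)
    rw [landenPullback, blaschke_cons, blaschke_cons, blaschke_cons,
      ih fun p' hp' => hl p' (by simp [hp']), ← mul_assoc]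
    congr 1
    have hr := Real.sq_sqrt (sub_nonneg.mpr hp.2)
    have hr0 := Real.sqrt_nonneg (p ^ 2 - c)
    have hrp : √(p ^ 2 - c) ≤ p := Real.sqrt_le_iff.mpr ⟨hp.1.le, by linarith⟩
    set r := √(p ^ 2 - c)
    have hcs : c = p ^ 2 - r ^ 2 := by linarith
    have h1 : s + (p + r) ≠ 0 := by linarith
    have h2 : s + (p - r) ≠ 0 := by linarith
    have h3 : (s + c / s) / 2 + p ≠ 0 := by
      have : 0 ≤ c / s := by positivity
      have := hp.1
      positivity
    have h4 : s ^ 2 + c + 2 * p * s ≠ 0 := by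
      have := hp.1
      positivity
    have e : ((s + c / s) / 2 - p) / ((s + c / s) / 2 + p) =
        (s ^ 2 + c - 2 * p * s) / (s ^ 2 + c + 2 * p * s) := by
      rw [div_eq_div_iff h3 h4]
      field_simp
    rw [e, div_mul_div_comm, div_eq_div_iff (mul_ne_zero h1 h2) h4, hcs]
    ring

theorem abs_div_le_of_mem_Icc {c d s : ℝ} (hd : 0 < d) (hdc : d < c) (h1 : d ^ 2 ≤ s)
    (h2 : s ≤ c ^ 2) : |(s - c * d) / (s + c * d)| ≤ (c - d) / (c + d) := by
  have hc : 0 < c := hd.trans hdc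
  have hcd : 0 < c * d := mul_pos hc hd
  have hs : 0 < s := lt_of_lt_of_le (by positivity) h1
  rw [abs_div, abs_of_pos (by positivity : 0 < s + c * d),
    div_le_div_iff₀ (by positivity) (by positivity)]
  have e : |s - c * d| * (c + d) = |(s - c * d) * (c + d)| := by
    rw [abs_mul, abs_of_pos (by positivity : 0 < c + d)]
  rw [e, abs_le]
  constructor <;> nlinarith

/-- Arithmetic-geometric mean iteration for the extremal rational functions of degree `2 ^ m` on
the interval `[θ₄², θ₃²]`. -/
theorem exists_blaschke_le_theta (m : ℕ) : ∀ {A : ℝ}, 0 < A → ∃ l : List ℝ, l.length = 2 ^ m ∧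
    (∀ p ∈ l, thetaFour A ^ 2 ≤ p ∧ p ≤ thetaThree A ^ 2) ∧
    ∀ s, thetaFour A ^ 2 ≤ s → s ≤ thetaThree A ^ 2 →
      |blaschke l s| ≤ 2 * Real.exp (-(2 ^ m * A)) := by
  induction m with
  | zero =>
    intro A hA
    have hd := thetaFour_pos hA
    have hdc := thetaFour_lt_thetaThree hA
    -- The optimal single zero is the geometric mean of the endpoints.
    refine ⟨[thetaThree A * thetaFour A], rfl, ?_, fun s h1 h2 => ?_⟩
    · intro p hp
      rw [List.mem_singleton] at hp
      subst hp
      constructor <;> nlinarith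
    · have h := abs_div_le_of_mem_Icc hd hdc h1 h2
      simp only [blaschke, List.map_cons, List.map_nil, List.prod_cons, List.prod_nil, mul_one,
        pow_zero, one_mul]
      refine h.trans ?_
      rw [div_le_iff₀ (by linarith)]
      exact thetaThree_sub_thetaFour_le hA
  | succ m ih =>
    intro A hA
    have hd := thetaFour_pos hA
    have hdc := thetaFour_lt_thetaThree hA
    have e1 := thetaThree_sq_add_thetaFour_sq hA
    have e2 := thetaThree_mul_thetaFour hA
    obtain ⟨l, hlen, hmem, hb⟩ := ih (A := 2 * A) (by positivity)
    rw [← e2] at hmem hb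
    have e3 : thetaThree (2 * A) ^ 2 = (thetaThree A ^ 2 + thetaFour A ^ 2) / 2 := by linarith
    rw [e3] at hmem hb
    set c := thetaThree A
    set d := thetaFour A
    have hcd : 0 < c * d := mul_pos (hd.trans hdc) hd
    have hl : ∀ p ∈ l, 0 < p ∧ (c * d) ^ 2 ≤ p ^ 2 := fun p hp =>
      ⟨hcd.trans_le (hmem p hp).1, pow_le_pow_left₀ hcd.le (hmem p hp).1 2⟩
    -- The map `s ↦ (s + (c d)² / s) / 2` sends `[d², c²]` into `[c d, (c² + d²) / 2]`, which is the
    -- interval for `2 * A`.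
    refine ⟨landenPullback ((c * d) ^ 2) l, ?_, ?_, ?_⟩
    · rw [length_landenPullback, hlen, pow_succ, mul_comm]
    · intro x hx
      obtain ⟨p, hp, hxp⟩ := exists_of_mem_landenPullback hx
      obtain ⟨hp1, hp2⟩ := hmem p hp
      have hr := Real.sq_sqrt (sub_nonneg.mpr (hl p hp).2)
      have hr0 := Real.sqrt_nonneg (p ^ 2 - (c * d) ^ 2)
      have hrle : √(p ^ 2 - (c * d) ^ 2) ≤ p - d ^ 2 := by
        refine Real.sqrt_le_iff.mpr ⟨by nlinarith, by nlinarith⟩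
      have hrle' : √(p ^ 2 - (c * d) ^ 2) ≤ c ^ 2 - p := by
        refine Real.sqrt_le_iff.mpr ⟨by nlinarith, by nlinarith⟩
      rcases hxp with rfl | rfl
      · constructor <;> linarith
      · constructor <;> linarith
    · intro s h1 h2
      have hs : 0 < s := lt_of_lt_of_le (by positivity) h1
      rw [blaschke_landenPullback (by positivity) hs hl]
      have := hb ((s + (c * d) ^ 2 / s) / 2) ?_ ?_
      · refine this.trans (le_of_eq ?_)
        congr 3
        ring
      · rw [le_div_iff₀ two_pos, ← sub_nonneg]
        have : s + (c * d) ^ 2 / s - c * d * 2 = (s - c * d) ^ 2 / s := by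
          field_simp
          ring
        rw [this]
        positivity
      · rw [div_le_div_iff_of_pos_right two_pos, ← sub_nonneg]
        have : c ^ 2 + d ^ 2 - (s + (c * d) ^ 2 / s) = (c ^ 2 - s) * (s - d ^ 2) / s := by
          field_simp
          ring
        rw [this]
        exact div_nonneg (mul_nonneg (by linarith) (by linarith)) hs.le

theorem blaschke_scale {u : ℝ} (hu : u ≠ 0) (l : List ℝ) (s : ℝ) :
    blaschke (l.map (u * ·)) (u * s) = blaschke l s := by
  induction l with
  | nil => rfl
  | cons p l ih =>
    rw [List.map_cons, blaschke_cons, blaschke_cons, ih, ← mul_sub, ← mul_add,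
      mul_div_mul_left _ _ hu]

/-- Bound for the Zolotarev number of degree `2 ^ m` of the interval `[ℓ b, b]` and its mirror
image. -/
theorem exists_blaschke_sq_le (m : ℕ) {l b : ℝ} (hl0 : 0 < l) (hl1 : l ≤ 1) (hb : 0 < b) :
    ∃ L : List ℝ, L.length = 2 ^ m ∧ (∀ p ∈ L, 0 < p) ∧ ∀ s, l * b ≤ s → s ≤ b →
      blaschke L s ^ 2 ≤
        4 * Real.exp (-(2 * 2 ^ m * (Real.pi ^ 2 / (2 * Real.log (4 / l))))) := by
  have hlog : 0 < Real.log (4 / l) := Real.log_pos (by rw [lt_div_iff₀ hl0]; linarith)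
  -- This `A` solves `4 exp (-π² / (2 A)) = l`, so `thetaFour_le` gives `θ₄² / θ₃² ≤ l`, and `[l b,
  -- b]` rescales into `[θ₄², θ₃²]`.
  set A := Real.pi ^ 2 / (2 * Real.log (4 / l)) with hAdef
  have hpi := Real.pi_pos
  have hA : 0 < A := by positivity
  obtain ⟨L, hlen, hmem, hbd⟩ := exists_blaschke_le_theta m hA
  have hd := thetaFour_pos hA
  have hc := thetaThree_pos hA
  have hratio : thetaFour A ^ 2 ≤ l * thetaThree A ^ 2 := by
    have h := thetaFour_le hA
    have e : Real.exp (-(Real.pi ^ 2 / A) / 4) ^ 2 = l / 4 := by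
      rw [← Real.exp_nat_mul]
      have : ((2 : ℕ) : ℝ) * (-(Real.pi ^ 2 / A) / 4) = Real.log (l / 4) := by
        rw [hAdef, ← inv_div 4 l, Real.log_inv]
        field_simp
        norm_num
      rw [this, Real.exp_log (by positivity)]
    calc thetaFour A ^ 2 ≤ (2 * Real.exp (-(Real.pi ^ 2 / A) / 4) * thetaThree A) ^ 2 :=
          pow_le_pow_left₀ hd.le h 2
      _ = 4 * Real.exp (-(Real.pi ^ 2 / A) / 4) ^ 2 * thetaThree A ^ 2 := by ring
      _ = l * thetaThree A ^ 2 := by rw [e]; ring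
  set u := b / thetaThree A ^ 2 with hu
  have hu0 : 0 < u := by positivity
  refine ⟨L.map (u * ·), by rw [List.length_map, hlen], ?_, fun s h1 h2 => ?_⟩
  · intro p hp
    obtain ⟨p', hp', rfl⟩ := List.mem_map.mp hp
    exact mul_pos hu0 (lt_of_lt_of_le (by positivity) (hmem p' hp').1)
  · have e : s = u * (s / u) := by field_simp
    rw [e, blaschke_scale hu0.ne', ← sq_abs]
    have hbu : b / u = thetaThree A ^ 2 := by rw [hu]; field_simp
    have h3 := hbd (s / u) ?_ ?_
    · calc |blaschke L (s / u)| ^ 2 ≤ (2 * Real.exp (-(2 ^ m * A))) ^ 2 :=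
            pow_le_pow_left₀ (abs_nonneg _) h3 2
        _ = 4 * Real.exp (-(2 * 2 ^ m * A)) := by
            rw [mul_pow, ← Real.exp_nat_mul]
            norm_num
            ring
    · refine hratio.trans ?_
      rw [← hbu, ← mul_div_assoc]
      exact div_le_div_of_nonneg_right h1 hu0.le
    · rw [← hbu]
      exact div_le_div_of_nonneg_right h2 hu0.le

/-! ### Diagonalization and the min-max principle -/

theorem exists_diagonalization {n : ℕ} {A : Matrix (Fin n) (Fin n) ℝ} (hA : A.IsHermitian) :
    ∃ (U : Matrix (Fin n) (Fin n) ℝ) (μ : Fin n → ℝ), U * Uᵀ = 1 ∧ Uᵀ * U = 1 ∧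
      A = U * diagonal μ * Uᵀ ∧ Antitone μ ∧
      ∀ (i : ℕ) (hi : 1 ≤ i ∧ i ≤ n), eig hA i hi = μ ⟨i - 1, by omega⟩ := by
  -- `eigenvalues` lists `eigenvalues₀` through an arbitrary equivalence; permuting the eigenvectors
  -- by the same one restores decreasing order.
  let e : Fin n ≃ Fin n := (finCongr (Fintype.card_fin n).symm).trans
    (Fintype.equivOfCardEq (Fintype.card_fin _))
  let V : Matrix (Fin n) (Fin n) ℝ := hA.eigenvectorUnitary
  have hV : V * Vᵀ = 1 := by
    have := Unitary.mul_star_self_of_mem hA.eigenvectorUnitary.2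
    rwa [star_eq_conjTranspose, conjTranspose_eq_transpose_of_trivial] at this
  have hs : A = V * diagonal hA.eigenvalues * Vᵀ := by
    have := hA.spectral_theorem
    rw [Unitary.conjStarAlgAut_apply, star_eq_conjTranspose,
      conjTranspose_eq_transpose_of_trivial] at this
    exact this
  have hU : V.submatrix id e * (V.submatrix id e)ᵀ = 1 := by
    rw [transpose_submatrix, submatrix_mul_equiv, hV, submatrix_id_id]
  refine ⟨V.submatrix id e, fun a => hA.eigenvalues₀ (Fin.cast (Fintype.card_fin n).symm a),
    hU, mul_eq_one_comm.mp hU, ?_, ?_, fun i hi => rfl⟩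
  · have hd : diagonal (fun a => hA.eigenvalues₀ (Fin.cast (Fintype.card_fin n).symm a)) =
        (diagonal hA.eigenvalues).submatrix e e := by
      rw [submatrix_diagonal_equiv]
      congr 1
      funext a
      simp [Matrix.IsHermitian.eigenvalues, e]
    rw [hd, transpose_submatrix, submatrix_mul_equiv, submatrix_mul_equiv, submatrix_id_id]
    exact hs
  · exact fun a b hab => hA.eigenvalues₀_antitone (by simpa using hab)

theorem dotProduct_conj_diagonal_mulVec {n : ℕ} (U : Matrix (Fin n) (Fin n) ℝ) (μ x y : Fin n → ℝ) :
    y ⬝ᵥ (U * diagonal μ * Uᵀ) *ᵥ x = ∑ a, μ a * ((Uᵀ *ᵥ y) a * (Uᵀ *ᵥ x) a) := by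
  rw [← mulVec_mulVec, ← mulVec_mulVec, dotProduct_mulVec, ← mulVec_transpose, dotProduct]
  refine Finset.sum_congr rfl fun a _ => ?_
  rw [mulVec_diagonal]
  ring

theorem dotProduct_transpose_mulVec {n : ℕ} {U : Matrix (Fin n) (Fin n) ℝ} (hU : U * Uᵀ = 1)
    (x y : Fin n → ℝ) : (Uᵀ *ᵥ y) ⬝ᵥ (Uᵀ *ᵥ x) = y ⬝ᵥ x := by
  rw [mulVec_transpose, ← dotProduct_mulVec, mulVec_mulVec, hU, one_mulVec]

theorem exists_ne_zero_of_length_lt {n : ℕ} (fs : List ((Fin n → ℝ) →ₗ[ℝ] ℝ))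
    (h : fs.length < n) : ∃ x : Fin n → ℝ, x ≠ 0 ∧ ∀ f ∈ fs, f x = 0 := by
  let L : (Fin n → ℝ) →ₗ[ℝ] (Fin fs.length → ℝ) := LinearMap.pi fun j => fs.get j
  have hk := LinearMap.ker_ne_bot_of_finrank_lt (f := L) (by simpa using h)
  obtain ⟨x, hx, hx0⟩ := (Submodule.ne_bot_iff _).mp hk
  refine ⟨x, hx0, fun f hf => ?_⟩
  obtain ⟨j, rfl⟩ := List.get_of_mem hf
  exact congrFun (LinearMap.mem_ker.mp hx) j

/-- The functionals reading the coordinates `m, m + 1, …, m + k - 1`. -/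
def coordList {n : ℕ} (m k : ℕ) (h : m + k ≤ n) : List ((Fin n → ℝ) →ₗ[ℝ] ℝ) :=
  List.ofFn fun j : Fin k => LinearMap.proj ⟨m + j, by omega⟩

theorem apply_eq_zero_of_coordList {n m k : ℕ} {h : m + k ≤ n} {x : Fin n → ℝ}
    (hx : ∀ f ∈ coordList m k h, f x = 0) (a : Fin n) (h1 : m ≤ a) (h2 : (a : ℕ) < m + k) :
    x a = 0 := by
  have := hx (LinearMap.proj a) (by
    rw [coordList, List.mem_ofFn]
    exact ⟨⟨a - m, by omega⟩, by congr 1; ext; simp only; omega⟩)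
  simpa using this

/-- Upper half of the Courant-Fischer principle: a bound for the quadratic form on the common
kernel of fewer than `i` functionals bounds the `i`-th eigenvalue. -/
theorem eig_le_of_forall {n : ℕ} {A : Matrix (Fin n) (Fin n) ℝ} (hA : A.IsHermitian) (i : ℕ)
    (hi : 1 ≤ i ∧ i ≤ n) (fs : List ((Fin n → ℝ) →ₗ[ℝ] ℝ)) (hfs : fs.length < i) {b : ℝ}
    (h : ∀ x : Fin n → ℝ, (∀ f ∈ fs, f x = 0) → x ⬝ᵥ A *ᵥ x ≤ b * (x ⬝ᵥ x)) :
    eig hA i hi ≤ b := by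
  obtain ⟨U, μ, hU, hU', hAU, hμ, hμi⟩ := exists_diagonalization hA
  -- Fewer than `i` functionals and `n - i` coordinates leave a nonzero vector in the span of the
  -- first `i` eigenvectors.
  obtain ⟨z, hz0, hz⟩ := exists_ne_zero_of_length_lt
    (fs.map (fun f => f ∘ₗ U.mulVecLin) ++ coordList i (n - i) (by omega)) (by
      simp only [List.length_append, List.length_map, coordList, List.length_ofFn]
      omega)
  have hz1 : ∀ f ∈ fs, f (U *ᵥ z) = 0 := fun f hf => by
    have := hz (f ∘ₗ U.mulVecLin) (List.mem_append_left _ (List.mem_map_of_mem hf))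
    simpa using this
  have hz2 : ∀ a : Fin n, i ≤ a → z a = 0 := fun a ha =>
    apply_eq_zero_of_coordList (fun f hf => hz f (List.mem_append_right _ hf)) a ha (by omega)
  have hUz : Uᵀ *ᵥ (U *ᵥ z) = z := by rw [mulVec_mulVec, hU', one_mulVec]
  have hq := h _ hz1
  rw [← dotProduct_transpose_mulVec hU (U *ᵥ z) (U *ᵥ z), hAU, dotProduct_conj_diagonal_mulVec,
    hUz] at hq
  have hpos : 0 < z ⬝ᵥ z := by
    have h0 : z ⬝ᵥ z ≠ 0 := fun h0 => hz0 (dotProduct_self_eq_zero.mp h0)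
    exact lt_of_le_of_ne (Finset.sum_nonneg fun a _ => mul_self_nonneg (z a)) h0.symm
  rw [hμi]
  refine le_of_mul_le_mul_right (le_trans ?_ hq) hpos
  rw [dotProduct, Finset.mul_sum]
  refine Finset.sum_le_sum fun a _ => ?_
  rcases lt_or_ge (a : ℕ) i with ha | ha
  · refine mul_le_mul_of_nonneg_right (hμ ?_) (mul_self_nonneg _)
    rw [Fin.le_def]
    simp only
    omega
  · rw [hz2 a ha]; simp

theorem dotProduct_mulVec_le_eig_one {n : ℕ} (hn : 1 ≤ n) {A : Matrix (Fin n) (Fin n) ℝ}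
    (hA : A.IsHermitian) (x : Fin n → ℝ) :
    x ⬝ᵥ A *ᵥ x ≤ eig hA 1 ⟨le_rfl, hn⟩ * (x ⬝ᵥ x) := by
  obtain ⟨U, μ, hU, hU', hAU, hμ, hμi⟩ := exists_diagonalization hA
  rw [hμi]
  conv_lhs => rw [hAU]
  rw [dotProduct_conj_diagonal_mulVec, ← dotProduct_transpose_mulVec hU, dotProduct,
    Finset.mul_sum]
  refine Finset.sum_le_sum fun a _ => mul_le_mul_of_nonneg_right (hμ ?_) (mul_self_nonneg _)
  rw [Fin.le_def]
  simp

theorem eig_le_eig_one {n : ℕ} (hn : 1 ≤ n) {A : Matrix (Fin n) (Fin n) ℝ}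
    (hA : A.IsHermitian) (i : ℕ) (hi : 1 ≤ i ∧ i ≤ n) :
    eig hA i hi ≤ eig hA 1 ⟨le_rfl, hn⟩ :=
  hA.eigenvalues₀_antitone (by rw [Fin.le_def]; simp)

/-! ### Quadratic forms with a displacement structure -/

/-- The quadratic form of `∑_{t < T} D^t y yᵀ D^t` for `D = diag κ`. -/
def krylovForm {n : ℕ} (κ y : Fin n → ℝ) (T : ℕ) (x : Fin n → ℝ) : ℝ :=
  ∑ t ∈ Finset.range T, (∑ a, κ a ^ t * (y a * x a)) ^ 2

/-- The Cayley transform `(1 - κ) / (1 + κ)`. -/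
def cayley (κ : ℝ) : ℝ := (1 - κ) / (1 + κ)

/-- With `z = x / ((1 - κ) + p (1 + κ))` and `uₜ = ∑ κᵗ y z`, the moments of `x` and of its image
are `(1 + p) uₜ - (1 - p) uₜ₊₁` and `(1 - p) uₜ - (1 + p) uₜ₊₁`. The difference of their squares
telescopes to `4 p (u_T² - u₀²)`, and the hypothesis on `x` says `u₀ = 0`. -/
theorem krylovForm_le_of_sum_eq_zero {n : ℕ} {κ : Fin n → ℝ} (hκ : ∀ a, 0 < κ a ∧ κ a < 1)
    (y : Fin n → ℝ) (T : ℕ) {p : ℝ} (hp : 0 < p) (x : Fin n → ℝ)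
    (hx : ∑ a, y a / ((1 - κ a) + p * (1 + κ a)) * x a = 0) :
    krylovForm κ y T x ≤
      krylovForm κ y T fun a => (cayley (κ a) - p) / (cayley (κ a) + p) * x a := by
  have hden : ∀ a, 0 < (1 - κ a) + p * (1 + κ a) := fun a => by
    have := hκ a
    nlinarith
  let z : Fin n → ℝ := fun a => x a / ((1 - κ a) + p * (1 + κ a))
  let u : ℕ → ℝ := fun t => ∑ a, κ a ^ t * (y a * z a)
  have h1 : ∀ t, ∑ a, κ a ^ t * (y a * x a) = (1 + p) * u t - (1 - p) * u (t + 1) := by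
    intro t
    simp only [u, Finset.mul_sum, ← Finset.sum_sub_distrib]
    refine Finset.sum_congr rfl fun a _ => ?_
    have : x a = ((1 - κ a) + p * (1 + κ a)) * z a := by
      simp only [z]; field_simp [(hden a).ne']
    rw [this]
    ring
  have h2 : ∀ t, ∑ a, κ a ^ t * (y a * ((cayley (κ a) - p) / (cayley (κ a) + p) * x a)) =
      (1 - p) * u t - (1 + p) * u (t + 1) := by
    intro t
    simp only [u, Finset.mul_sum, ← Finset.sum_sub_distrib]
    refine Finset.sum_congr rfl fun a _ => ?_
    have hκa : 1 + κ a ≠ 0 := by linarith [(hκ a).1]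
    have hc : (cayley (κ a) - p) / (cayley (κ a) + p) =
        ((1 - κ a) - p * (1 + κ a)) / ((1 - κ a) + p * (1 + κ a)) := by
      have e1 : cayley (κ a) - p = ((1 - κ a) - p * (1 + κ a)) / (1 + κ a) := by
        unfold cayley; field_simp
      have e2 : cayley (κ a) + p = ((1 - κ a) + p * (1 + κ a)) / (1 + κ a) := by
        unfold cayley; field_simp
      rw [e1, e2, div_div_div_cancel_right₀ hκa]
    have : (cayley (κ a) - p) / (cayley (κ a) + p) * x a = ((1 - κ a) - p * (1 + κ a)) * z a := by
      rw [hc]; simp only [z]; ring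
    rw [this]
    ring
  have hu0 : u 0 = 0 := by
    rw [← hx]
    refine Finset.sum_congr rfl fun a _ => ?_
    simp only [z]
    ring
  have htel : ∑ t ∈ Finset.range T, (u (t + 1) ^ 2 - u t ^ 2) = u T ^ 2 - u 0 ^ 2 :=
    Finset.sum_range_sub (fun t => u t ^ 2) T
  have hdiff : krylovForm κ y T (fun a => (cayley (κ a) - p) / (cayley (κ a) + p) * x a) -
      krylovForm κ y T x = 4 * p * ∑ t ∈ Finset.range T, (u (t + 1) ^ 2 - u t ^ 2) := by
    simp only [krylovForm]
    rw [← Finset.sum_sub_distrib, Finset.mul_sum]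
    refine Finset.sum_congr rfl fun t _ => ?_
    rw [h1, h2]
    ring
  rw [htel, hu0] at hdiff
  have : 0 ≤ 4 * p * (u T ^ 2 - 0 ^ 2) := by
    have := sq_nonneg (u T)
    rw [zero_pow two_ne_zero, sub_zero]
    positivity
  linarith

/-- One functional per zero suffices to compare the form with its image under the rational
function. -/
theorem exists_functionals_krylovForm_le {n : ℕ} {κ : Fin n → ℝ} (hκ : ∀ a, 0 < κ a ∧ κ a < 1)
    (y : Fin n → ℝ) (T : ℕ) (l : List ℝ) (hl : ∀ p ∈ l, 0 < p) :
    ∃ fs : List ((Fin n → ℝ) →ₗ[ℝ] ℝ), fs.length = l.length ∧ ∀ x : Fin n → ℝ,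
      (∀ f ∈ fs, f x = 0) →
        krylovForm κ y T x ≤ krylovForm κ y T fun a => blaschke l (cayley (κ a)) * x a := by
  induction l with
  | nil => exact ⟨[], rfl, fun x _ => by simp [blaschke]⟩
  | cons p l ih =>
    obtain ⟨fs, hlen, hfs⟩ := ih fun q hq => hl q (by simp [hq])
    let w : Fin n → ℝ := fun a => (cayley (κ a) - p) / (cayley (κ a) + p)
    let f₀ : (Fin n → ℝ) →ₗ[ℝ] ℝ :=
      ∑ a, (y a / ((1 - κ a) + p * (1 + κ a))) • (LinearMap.proj a : (Fin n → ℝ) →ₗ[ℝ] ℝ)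
    -- The remaining conditions are imposed on `w x`, the vector already multiplied by the first
    -- factor.
    refine ⟨f₀ :: fs.map (fun f => f ∘ₗ (diagonal w).mulVecLin), by simp [hlen], fun x hx => ?_⟩
    have h0 := hx f₀ (by simp)
    have h1 : ∀ f ∈ fs, f (fun a => w a * x a) = 0 := fun f hf => by
      have := hx (f ∘ₗ (diagonal w).mulVecLin)
        (List.mem_cons_of_mem _ (List.mem_map_of_mem hf))
      rw [LinearMap.comp_apply, mulVecLin_apply] at this
      have e : diagonal w *ᵥ x = fun a => w a * x a := funext fun a => mulVec_diagonal _ _ _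
      rwa [e] at this
    refine (krylovForm_le_of_sum_eq_zero hκ y T (hl p (by simp)) x ?_).trans ?_
    · simpa [f₀] using h0
    · refine (hfs _ h1).trans (le_of_eq ?_)
      congr 1
      funext a
      rw [blaschke_cons]
      simp only [w]
      ring

/-! ### The quadratic form of `P₁` in the eigenbasis of `K` -/

theorem stepMatrix_conj_diagonal_pow {n : ℕ} {U : Matrix (Fin n) (Fin n) ℝ} (hU : U * Uᵀ = 1)
    (hU' : Uᵀ * U = 1) (μ : Fin n → ℝ) (α : ℝ) (t : ℕ) :
    stepMatrix α (U * diagonal μ * Uᵀ) ^ t =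
      U * diagonal (fun a => (1 - α * μ a) ^ t) * Uᵀ := by
  have h1 : stepMatrix α (U * diagonal μ * Uᵀ) = U * diagonal (fun a => 1 - α * μ a) * Uᵀ := by
    have hd : diagonal (fun a => 1 - α * μ a) = 1 - α • diagonal μ := by
      rw [← diagonal_one, ← diagonal_smul, ← diagonal_sub]
      rfl
    rw [hd, Matrix.mul_sub, Matrix.sub_mul, Matrix.mul_one, hU, Matrix.mul_smul, Matrix.smul_mul]
    rfl
  induction t with
  | zero => simp [hU]
  | succ t ih =>
    rw [pow_succ, ih, h1]
    calc U * diagonal (fun a => (1 - α * μ a) ^ t) * Uᵀ *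
          (U * diagonal (fun a => 1 - α * μ a) * Uᵀ)
        = U * (diagonal (fun a => (1 - α * μ a) ^ t) * (Uᵀ * U) *
            diagonal (fun a => 1 - α * μ a)) * Uᵀ := by simp only [Matrix.mul_assoc]
      _ = _ := by
        rw [hU', Matrix.mul_one, diagonal_mul_diagonal]
        simp only [pow_succ]

/-- The eigenvalue of `P₁^{σ_w}(T)` belonging to the eigenvalue `u` of `K`. -/
def initEigenvalue (α σw : ℝ) (T : ℕ) (u : ℝ) : ℝ :=
  σw ^ 2 / (T : ℝ) * (u * ∑ t ∈ Finset.range T, (1 - α * u) ^ (2 * t))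

theorem dotProduct_P1_mulVec {n : ℕ} {K U : Matrix (Fin n) (Fin n) ℝ} {μ : Fin n → ℝ}
    (hU : U * Uᵀ = 1) (hU' : Uᵀ * U = 1) (hK : K = U * diagonal μ * Uᵀ) (α σw : ℝ) (T : ℕ)
    (y x : Fin n → ℝ) :
    x ⬝ᵥ P1 α σw T K y *ᵥ x =
      ∑ a, initEigenvalue α σw T (μ a) * ((Uᵀ *ᵥ x) a * (Uᵀ *ᵥ x) a) +
        1 / (T : ℝ) * krylovForm (fun a => 1 - α * μ a) (Uᵀ *ᵥ y) T (Uᵀ *ᵥ x) := by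
  have hKH : K.IsHermitian := by
    rw [hK]
    unfold Matrix.IsHermitian
    rw [conjTranspose_eq_transpose_of_trivial, transpose_mul, transpose_mul, transpose_transpose,
      diagonal_transpose, Matrix.mul_assoc]
  have hpow := stepMatrix_conj_diagonal_pow hU hU' μ α
  rw [← hK] at hpow
  unfold P1 P1Init P1Target
  rw [add_mulVec, dotProduct_add, smul_mulVec, smul_mulVec, dotProduct_smul, dotProduct_smul,
    sum_mulVec, sum_mulVec, dotProduct_sum, dotProduct_sum]
  congr 1
  · have h : ∀ t, x ⬝ᵥ (stepMatrix α K ^ (2 * t) * K) *ᵥ x =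
        ∑ a, (1 - α * μ a) ^ (2 * t) * μ a * ((Uᵀ *ᵥ x) a * (Uᵀ *ᵥ x) a) := by
      intro t
      rw [← dotProduct_conj_diagonal_mulVec U (fun a => (1 - α * μ a) ^ (2 * t) * μ a)]
      congr 2
      rw [hpow, hK]
      calc U * diagonal (fun a => (1 - α * μ a) ^ (2 * t)) * Uᵀ * (U * diagonal μ * Uᵀ)
          = U * (diagonal (fun a => (1 - α * μ a) ^ (2 * t)) * (Uᵀ * U) * diagonal μ) * Uᵀ := by
            simp only [Matrix.mul_assoc]
        _ = _ := by rw [hU', Matrix.mul_one, diagonal_mul_diagonal]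
    simp only [h, smul_eq_mul]
    rw [Finset.sum_comm, Finset.mul_sum]
    refine Finset.sum_congr rfl fun a _ => ?_
    rw [← Finset.sum_mul, ← Finset.sum_mul, initEigenvalue]
    ring
  · rw [smul_eq_mul, krylovForm]
    congr 1
    refine Finset.sum_congr rfl fun t _ => ?_
    have hsymm : (stepMatrix α K ^ t)ᵀ = stepMatrix α K ^ t := by
      have := ((stepMatrix_isHermitian α hKH).pow t).eq
      rwa [conjTranspose_eq_transpose_of_trivial] at this
    have hy : y ⬝ᵥ stepMatrix α K ^ t *ᵥ x =
        ∑ a, (1 - α * μ a) ^ t * ((Uᵀ *ᵥ y) a * (Uᵀ *ᵥ x) a) := by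
      rw [hpow, dotProduct_conj_diagonal_mulVec]
    rw [← hy, ← mulVec_mulVec, ← mulVec_mulVec, vecMulVec_mulVec, dotProduct_mulVec,
      ← mulVec_transpose, hsymm, dotProduct_smul, op_smul_eq_smul, smul_eq_mul, sq,
      dotProduct_comm _ y]

section InitEigenvalue

variable {α σw u : ℝ} {T : ℕ}

theorem initEigenvalue_nonneg (hα : 0 ≤ 1 - α * u) (hu : 0 ≤ u) :
    0 ≤ initEigenvalue α σw T u := by
  unfold initEigenvalue
  have : 0 ≤ ∑ t ∈ Finset.range T, (1 - α * u) ^ (2 * t) :=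
    Finset.sum_nonneg fun t _ => pow_nonneg hα _
  positivity

theorem initEigenvalue_le_mul (hT : 1 ≤ T) (hα0 : 0 ≤ α) (hα : 0 ≤ 1 - α * u) (hu : 0 ≤ u) :
    initEigenvalue α σw T u ≤ σw ^ 2 * u := by
  have hT' : (0 : ℝ) < T := by exact_mod_cast hT
  have h : ∑ t ∈ Finset.range T, (1 - α * u) ^ (2 * t) ≤ T := by
    have := Finset.sum_le_sum (s := Finset.range T) fun t _ =>
      pow_le_one₀ (n := 2 * t) hα (by nlinarith [mul_nonneg hα0 hu])
    simpa using this
  unfold initEigenvalue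
  calc _ ≤ σw ^ 2 / (T : ℝ) * (u * T) := by gcongr
    _ = σw ^ 2 * u := by field_simp

/-- The geometric sum `S` satisfies `α u (2 - α u) S ≤ 1`, and `2 - α u ≥ 1`. -/
theorem initEigenvalue_le_div (hα0 : 0 < α) (hα : 0 ≤ 1 - α * u) (hu : 0 ≤ u) :
    initEigenvalue α σw T u ≤ σw ^ 2 / (α * T) := by
  set S := ∑ t ∈ Finset.range T, (1 - α * u) ^ (2 * t) with hS
  have hS0 : 0 ≤ S := Finset.sum_nonneg fun t _ => pow_nonneg hα _
  have hgeom : S * ((1 - α * u) ^ 2 - 1) = ((1 - α * u) ^ 2) ^ T - 1 := by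
    simp only [hS, pow_mul]
    exact geom_sum_mul _ _
  have hαu : 0 ≤ α * u := mul_nonneg hα0.le hu
  have hle : u * S ≤ 1 / α := by
    rw [le_div_iff₀ hα0]
    have h1 : 0 ≤ ((1 - α * u) ^ 2) ^ T := by positivity
    have h2 : 0 ≤ S * (α * u) * (1 - α * u) := by positivity
    nlinarith
  unfold initEigenvalue
  calc _ ≤ σw ^ 2 / (T : ℝ) * (1 / α) := mul_le_mul_of_nonneg_left hle (by positivity)
    _ = _ := by rw [div_mul_div_comm, mul_one, mul_comm (T : ℝ)]

end InitEigenvalue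

/-- Test the Rayleigh quotient at `y` and keep only the term `t = 0` of the Krylov form. -/
theorem le_eig_one_P1 {n : ℕ} (hn : 1 ≤ n) {K U : Matrix (Fin n) (Fin n) ℝ} {μ : Fin n → ℝ}
    (hU : U * Uᵀ = 1) (hU' : Uᵀ * U = 1) (hK : K = U * diagonal μ * Uᵀ) {α σw : ℝ} {T : ℕ}
    (hT : 1 ≤ T) (hμ : ∀ a, 0 ≤ μ a) (hκ : ∀ a, 0 ≤ 1 - α * μ a) {y : Fin n → ℝ} (hy : y ≠ 0)
    (hP : (P1 α σw T K y).IsHermitian) :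
    (y ⬝ᵥ y) / T ≤ eig hP 1 ⟨le_rfl, hn⟩ := by
  have hT' : (0 : ℝ) < T := by exact_mod_cast hT
  have hyy : 0 < y ⬝ᵥ y := lt_of_le_of_ne (Finset.sum_nonneg fun a _ => mul_self_nonneg (y a))
    fun h0 => hy (dotProduct_self_eq_zero.mp h0.symm)
  have h := dotProduct_mulVec_le_eig_one hn hP y
  rw [dotProduct_P1_mulVec hU hU' hK] at h
  have h1 : 0 ≤ ∑ a, initEigenvalue α σw T (μ a) * ((Uᵀ *ᵥ y) a * (Uᵀ *ᵥ y) a) :=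
    Finset.sum_nonneg fun a _ =>
      mul_nonneg (initEigenvalue_nonneg (hκ a) (hμ a)) (mul_self_nonneg _)
  have h2 : (y ⬝ᵥ y) ^ 2 ≤
      krylovForm (fun a => 1 - α * μ a) (Uᵀ *ᵥ y) T (Uᵀ *ᵥ y) := by
    have e : (y ⬝ᵥ y) ^ 2 =
        (∑ a, (1 - α * μ a) ^ 0 * ((Uᵀ *ᵥ y) a * (Uᵀ *ᵥ y) a)) ^ 2 := by
      rw [← dotProduct_transpose_mulVec hU]
      simp [dotProduct]
    rw [e]
    exact Finset.single_le_sum (f := fun t =>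
      (∑ a, (1 - α * μ a) ^ t * ((Uᵀ *ᵥ y) a * (Uᵀ *ᵥ y) a)) ^ 2)
      (fun t _ => sq_nonneg _) (Finset.mem_range.mpr hT)
  have h3 : (y ⬝ᵥ y) / T * (y ⬝ᵥ y) ≤ eig hP 1 ⟨le_rfl, hn⟩ * (y ⬝ᵥ y) := by
    refine le_trans ?_ h
    calc (y ⬝ᵥ y) / T * (y ⬝ᵥ y) = 1 / (T : ℝ) * (y ⬝ᵥ y) ^ 2 := by ring
      _ ≤ 1 / (T : ℝ) * krylovForm (fun a => 1 - α * μ a) (Uᵀ *ᵥ y) T (Uᵀ *ᵥ y) :=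
          mul_le_mul_of_nonneg_left h2 (by positivity)
      _ ≤ _ := le_add_of_nonneg_left h1
  exact le_of_mul_le_mul_right h3 hyy

/-- A rational function with `l.length` zeros and the first `m` eigenvectors of `K` control the
eigenvalues of `P₁` of index larger than `l.length + m`. -/
theorem eig_P1_le {n : ℕ} (hn : 1 ≤ n) {K U : Matrix (Fin n) (Fin n) ℝ} {μ : Fin n → ℝ}
    (hU : U * Uᵀ = 1) (hU' : Uᵀ * U = 1) (hK : K = U * diagonal μ * Uᵀ) {α σw : ℝ} {T : ℕ}
    (hα : 0 < α) (hμ : ∀ a, 0 < μ a) (hκ : ∀ a, 0 < 1 - α * μ a) {y : Fin n → ℝ}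
    (hP : (P1 α σw T K y).IsHermitian) (hP1 : 0 ≤ eig hP 1 ⟨le_rfl, hn⟩)
    (l : List ℝ) (hl : ∀ p ∈ l, 0 < p) {δ : ℝ}
    (hδ : ∀ a, blaschke l (cayley (1 - α * μ a)) ^ 2 ≤ δ) (m : ℕ) {G : ℝ}
    (hG : ∀ a : Fin n, m ≤ a → initEigenvalue α σw T (μ a) ≤ G) (i : ℕ) (hi : 1 ≤ i ∧ i ≤ n)
    (hlm : l.length + m < i) :
    eig hP i hi ≤ δ * eig hP 1 ⟨le_rfl, hn⟩ + G := by
  have hκ' : ∀ a, 0 < 1 - α * μ a ∧ 1 - α * μ a < 1 := fun a =>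
    ⟨hκ a, by linarith [mul_pos hα (hμ a)]⟩
  obtain ⟨fs, hlen, hfs⟩ := exists_functionals_krylovForm_le hκ' (Uᵀ *ᵥ y) T l hl
  refine eig_le_of_forall hP i hi
    ((fs ++ coordList 0 m (by omega)).map fun f => f ∘ₗ Uᵀ.mulVecLin) ?_ fun x hx => ?_
  · simp only [List.length_map, List.length_append, coordList, List.length_ofFn]
    omega
  have hx' : ∀ f ∈ fs ++ coordList 0 m (by omega), f (Uᵀ *ᵥ x) = 0 := fun f hf => by
    exact hx _ (List.mem_map_of_mem hf)
  have hcoord : ∀ a : Fin n, (a : ℕ) < m → (Uᵀ *ᵥ x) a = 0 := fun a ha =>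
    apply_eq_zero_of_coordList (fun f hf => hx' f (List.mem_append_right _ hf)) a (Nat.zero_le _)
      (by omega)
  have hkry := hfs _ fun f hf => hx' f (List.mem_append_left _ hf)
  have hxx := dotProduct_transpose_mulVec hU x x
  rw [dotProduct_P1_mulVec hU hU' hK]
  set z := Uᵀ *ᵥ x
  set z' : Fin n → ℝ := fun a => blaschke l (cayley (1 - α * μ a)) * z a
  have hz' : Uᵀ *ᵥ (U *ᵥ z') = z' := by rw [mulVec_mulVec, hU', one_mulVec]
  have h1 : ∑ a, initEigenvalue α σw T (μ a) * (z a * z a) ≤ G * (x ⬝ᵥ x) := by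
    rw [← hxx, dotProduct, Finset.mul_sum]
    refine Finset.sum_le_sum fun a _ => ?_
    rcases lt_or_ge (a : ℕ) m with ha | ha
    · rw [hcoord a ha]; simp
    · exact mul_le_mul_of_nonneg_right (hG a ha) (mul_self_nonneg _)
  -- The Krylov part is dominated by all of `P₁`, since the diagonal part is nonnegative.
  have h2 : 1 / (T : ℝ) * krylovForm (fun a => 1 - α * μ a) (Uᵀ *ᵥ y) T z' ≤
      eig hP 1 ⟨le_rfl, hn⟩ * (z' ⬝ᵥ z') := by
    have h := dotProduct_mulVec_le_eig_one hn hP (U *ᵥ z')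
    rw [dotProduct_P1_mulVec hU hU' hK, ← dotProduct_transpose_mulVec hU (U *ᵥ z'), hz'] at h
    refine le_trans (le_add_of_nonneg_left ?_) h
    exact Finset.sum_nonneg fun a _ =>
      mul_nonneg (initEigenvalue_nonneg (hκ a).le (hμ a).le) (mul_self_nonneg _)
  have h3 : z' ⬝ᵥ z' ≤ δ * (x ⬝ᵥ x) := by
    rw [← hxx, dotProduct, dotProduct, Finset.mul_sum]
    refine Finset.sum_le_sum fun a _ => ?_
    calc z' a * z' a = blaschke l (cayley (1 - α * μ a)) ^ 2 * (z a * z a) := by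
          simp only [z']; ring
      _ ≤ δ * (z a * z a) := mul_le_mul_of_nonneg_right (hδ a) (mul_self_nonneg _)
  have h4 := mul_le_mul_of_nonneg_left hkry (by positivity : 0 ≤ 1 / (T : ℝ))
  have h5 := mul_le_mul_of_nonneg_left h3 hP1
  linarith

/-- Here `cayley (1 - α v) = α v / (2 - α v)` increases in `v`; the ratio of its values at `u` and
`1` is smallest at `α = 1`, where it is `u / (2 - u)`. -/
theorem cayley_mem_Icc {α u v : ℝ} (hα0 : 0 < α) (hα1 : α ≤ 1) (hu : 0 < u) (huv : u ≤ v)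
    (hv : v ≤ 1) :
    u / (2 - u) * cayley (1 - α) ≤ cayley (1 - α * v) ∧ cayley (1 - α * v) ≤ cayley (1 - α) := by
  have hαv : α * v ≤ 1 := by nlinarith
  have hαv0 : 0 < α * v := mul_pos hα0 (hu.trans_le huv)
  have e : ∀ w, cayley (1 - w) = w / (2 - w) := fun w => by
    unfold cayley
    congr 1 <;> ring
  rw [e, e]
  constructor
  · rw [div_mul_div_comm, div_le_div_iff₀ (by nlinarith) (by linarith)]
    have h1 : 0 ≤ (1 - α) * (1 - u) := mul_nonneg (by linarith) (by linarith)
    have h2 : u * (2 - α * v) ≤ v * (2 - α * u) := by nlinarith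
    have h3 : v * (2 - α * u) ≤ v * ((2 - u) * (2 - α)) :=
      mul_le_mul_of_nonneg_left (by nlinarith) (hu.trans_le huv).le
    nlinarith [mul_le_mul_of_nonneg_left (h2.trans h3) hα0.le]
  · rw [div_le_div_iff₀ (by linarith) (by linarith)]
    nlinarith

/-! ### The spectral bound for `P₁` with a sloppy kernel -/

/-- The eigenvalue bound with `2 ^ e` zeros of the rational function and `m` eigenvectors of `K`. -/
theorem eig_P1_le_of_sloppy {n : ℕ} (hn : 1 ≤ n) {K U : Matrix (Fin n) (Fin n) ℝ} {c α σw : ℝ}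
    {T : ℕ} (hU : U * Uᵀ = 1) (hU' : Uᵀ * U = 1)
    (hK : K = U * diagonal (fun a : Fin n => Real.exp (-(a : ℝ) * c)) * Uᵀ) (hc : 0 < c)
    (hα0 : 0 < α) (hα1 : α < 1) {y : Fin n → ℝ} (hP : (P1 α σw T K y).IsHermitian)
    (hP1 : 0 ≤ eig hP 1 ⟨le_rfl, hn⟩) (e m : ℕ) {G : ℝ}
    (hG : ∀ a : Fin n, m ≤ a → initEigenvalue α σw T (Real.exp (-(a : ℝ) * c)) ≤ G)
    (i : ℕ) (hi : 1 ≤ i ∧ i ≤ n) (hem : 2 ^ e + m < i) :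
    eig hP i hi ≤ 4 * Real.exp (-(2 * 2 ^ e * (Real.pi ^ 2 /
        (2 * Real.log (8 * 1 / Real.exp (-((n : ℝ) - 1) * c) - 4))))) *
      eig hP 1 ⟨le_rfl, hn⟩ + G := by
  set u := Real.exp (-((n : ℝ) - 1) * c) with hu
  have hu0 : 0 < u := Real.exp_pos _
  have hn' : (1 : ℝ) ≤ n := by exact_mod_cast hn
  have hu1 : u ≤ 1 := Real.exp_le_one_iff.mpr (by nlinarith)
  have hμ1 : ∀ a : Fin n, Real.exp (-(a : ℝ) * c) ≤ 1 := fun a =>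
    Real.exp_le_one_iff.mpr (by nlinarith [(Nat.cast_nonneg a : (0 : ℝ) ≤ ((a : ℕ) : ℝ))])
  have hμu : ∀ a : Fin n, u ≤ Real.exp (-(a : ℝ) * c) := fun a => by
    rw [hu, Real.exp_le_exp]
    have : ((a : ℕ) : ℝ) + 1 ≤ n := by exact_mod_cast a.2
    nlinarith
  have hb : 0 < cayley (1 - α) := by
    unfold cayley
    exact div_pos (by linarith) (by linarith)
  obtain ⟨L, hlen, hpos, hL⟩ := exists_blaschke_sq_le e (l := u / (2 - u)) (b := cayley (1 - α))
    (div_pos hu0 (by linarith)) (by rw [div_le_one (by linarith)]; linarith) hb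
  -- Source of the expression `8 λ₁ / λ_n - 4` in `ρ`.
  have hx : 4 / (u / (2 - u)) = 8 * 1 / u - 4 := by
    have : 2 - u ≠ 0 := by linarith
    field_simp
    ring
  rw [hx] at hL
  refine eig_P1_le hn hU hU' hK hα0 (fun a => Real.exp_pos _) (fun a => ?_) hP hP1 L hpos
    (fun a => ?_) m hG i hi (by rw [hlen]; exact hem)
  · nlinarith [hμ1 a, Real.exp_pos (-(a : ℝ) * c)]
  · obtain ⟨h1, h2⟩ := cayley_mem_Icc hα0 hα1.le hu0 (hμu a) (hμ1 a)
    exact hL _ h1 h2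

/-- `ρ ≤ 4` as soon as `λ₁ / λ_n` is at least `8`. -/
theorem pi_sq_div_log_le {x : ℝ} (hx : 8 ≤ x) :
    Real.pi ^ 2 / (2 * Real.log (8 * x - 4)) ≤ Real.log 4 := by
  have h2 := Real.log_two_gt_d9
  have h4 : Real.log 4 = 2 * Real.log 2 := by
    rw [← Real.log_rpow two_pos]; norm_num
  -- From `60² ≥ 2 ^ 11`; the exponent `11 / 2` suffices because `π² ≤ 22 (log 2)²`.
  have h60 : 11 / 2 * Real.log 2 ≤ Real.log (8 * x - 4) := by
    have h : Real.log ((2 : ℝ) ^ 11) ≤ Real.log ((8 * x - 4) ^ 2) :=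
      Real.log_le_log (by norm_num) (by nlinarith)
    rw [Real.log_pow, Real.log_pow] at h
    push_cast at h
    linarith
  have hpi := Real.pi_lt_d2
  have hpi0 := Real.pi_pos
  rw [h4, div_le_iff₀ (by linarith)]
  nlinarith

/-- Given a budget of `d` zeros, a power of two fits whose double, the exponent of `ρ`, still
exceeds `d`. -/
theorem exists_two_pow_le_lt {d : ℕ} (hd : 1 ≤ d) : ∃ e : ℕ, 2 ^ e ≤ d ∧ d + 1 ≤ 2 * 2 ^ e :=
  ⟨Nat.log 2 d, Nat.pow_log_le_self 2 (by omega), by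
    have := Nat.lt_pow_succ_log_self (b := 2) (by norm_num) d
    rw [pow_succ] at this
    omega⟩

end Sloppy

end

/-! ### Choice of the numbers of zeros and of removed eigenvectors -/

theorem lemma3 {n d : ℕ} (hn : 1 ≤ n) (X : Matrix (Fin n) (Fin d) ℝ) (wstar : Fin d → ℝ)
    (c α σw : ℝ) (T : ℕ) (hc : 0 < c) (hT : 1 ≤ T)
    (hK : ∀ (i : ℕ) (hi : 1 ≤ i ∧ i ≤ n),
      Sloppy.eig (Sloppy.kernel_isHermitian X) i hi = Sloppy.sloppy c (i : ℝ))
    (hα0 : 0 < α)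
    (hα1 : α < 1 / Sloppy.eig (Sloppy.kernel_isHermitian X) 1 ⟨le_rfl, hn⟩)
    (hy : Sloppy.target X wstar ≠ 0) :
    let y : Fin n → ℝ := Sloppy.target X wstar
    let hP := Sloppy.P1_isHermitian α σw T (Sloppy.kernel_isHermitian X) y
    let ρ : ℝ := Sloppy.rho (Sloppy.eig (Sloppy.kernel_isHermitian X) 1 ⟨le_rfl, hn⟩)
      (Sloppy.eig (Sloppy.kernel_isHermitian X) n ⟨hn, le_rfl⟩)
    let k : ℝ := Sloppy.kstar n T α c
    let r : ℝ := σw ^ 2 / (α * ‖WithLp.toLp 2 y‖ ^ 2)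
    ∀ (i : ℕ) (hi : 1 ≤ i ∧ i ≤ n),
      ((i : ℝ) ≤ 2 * k →
        Sloppy.eig hP i hi / Sloppy.eig hP 1 ⟨le_rfl, hn⟩
          ≤ min 1 (4 * ρ ^ (-((i : ℝ) - 1)) + r)) ∧
      (2 * k < (i : ℝ) →
        Sloppy.eig hP i hi / Sloppy.eig hP 1 ⟨le_rfl, hn⟩
          ≤ 4 * ρ ^ (-(k - 1)) +
            r * min 1 (2 * α * (T : ℝ) * Sloppy.sloppy c ((i : ℝ) - k + 1))) := by
  intro y hP ρ k r i hi
  obtain ⟨U, μ, hU, hU', hKU, -, hμ⟩ := Sloppy.exists_diagonalization (Sloppy.kernel_isHermitian X)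
  have hμe : μ = fun a : Fin n => Real.exp (-(a : ℝ) * c) := by
    funext a
    have h1 := hμ (a + 1) ⟨by omega, by omega⟩
    rw [hK] at h1
    simp only [Nat.add_sub_cancel, Fin.eta] at h1
    rw [← h1, Sloppy.sloppy]
    push_cast
    congr 1
    ring
  rw [hμe] at hKU
  have h11 : Sloppy.eig (Sloppy.kernel_isHermitian X) 1 ⟨le_rfl, hn⟩ = 1 := by
    rw [hK, Sloppy.sloppy]; simp
  rw [h11, div_one] at hα1
  have hT' : (0 : ℝ) < T := by exact_mod_cast hT
  have hμ0 : ∀ a : Fin n, 0 < Real.exp (-(a : ℝ) * c) := fun a => Real.exp_pos _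
  have hμ1 : ∀ a : Fin n, 0 ≤ 1 - α * Real.exp (-(a : ℝ) * c) := fun a => by
    have : Real.exp (-(a : ℝ) * c) ≤ 1 :=
      Real.exp_le_one_iff.mpr (by nlinarith [(Nat.cast_nonneg a : (0 : ℝ) ≤ ((a : ℕ) : ℝ))])
    nlinarith [hμ0 a]
  have hyy : ‖WithLp.toLp 2 y‖ ^ 2 = y ⬝ᵥ y := by
    rw [EuclideanSpace.norm_sq_eq]
    simp [dotProduct, sq]
  have hyy0 : 0 < y ⬝ᵥ y := lt_of_le_of_ne (Finset.sum_nonneg fun a _ => mul_self_nonneg (y a))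
    fun h0 => hy (dotProduct_self_eq_zero.mp h0.symm)
  have hr : r = σw ^ 2 / (α * (y ⬝ᵥ y)) := by simp only [r, hyy]
  have hr0 : 0 ≤ r := by rw [hr]; positivity
  have hE1 := Sloppy.le_eig_one_P1 hn hU hU' hKU hT (fun a => (hμ0 a).le) hμ1 hy hP
  set E := Sloppy.eig hP 1 ⟨le_rfl, hn⟩ with hE
  have hE0 : 0 < E := lt_of_lt_of_le (by positivity) hE1
  set Λ := Real.pi ^ 2 / (2 * Real.log (8 * 1 / Real.exp (-((n : ℝ) - 1) * c) - 4)) with hΛ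
  have hρ : ∀ x : ℝ, ρ ^ x = Real.exp (Λ * x) := fun x => by
    have : ρ = Real.exp Λ := by
      simp only [ρ, Sloppy.rho, h11, hK, Sloppy.sloppy, hΛ]
    rw [this, ← Real.exp_mul]
  have hn' : (1 : ℝ) ≤ n := by exact_mod_cast hn
  have hΛ0 : 0 ≤ Λ := by
    have h1 : Real.exp (-((n : ℝ) - 1) * c) ≤ 1 := Real.exp_le_one_iff.mpr (by nlinarith)
    have h2 : (8 : ℝ) ≤ 8 * 1 / Real.exp (-((n : ℝ) - 1) * c) := by
      rw [le_div_iff₀ (Real.exp_pos _)]; linarith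
    have := Real.log_nonneg (by linarith :
      (1 : ℝ) ≤ 8 * 1 / Real.exp (-((n : ℝ) - 1) * c) - 4)
    positivity
  have hle1 : Sloppy.eig hP i hi / E ≤ 1 := by
    rw [div_le_one hE0]
    exact Sloppy.eig_le_eig_one hn hP i hi
  have hG : ∀ η G : ℝ, 0 ≤ η → G ≤ σw ^ 2 / (α * T) * η → G / E ≤ r * η := by
    intro η G hη hGη
    rw [div_le_iff₀ hE0]
    calc G ≤ σw ^ 2 / (α * T) * η := hGη
      _ = r * η * ((y ⬝ᵥ y) / T) := by rw [hr]; field_simp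
      _ ≤ r * η * E := mul_le_mul_of_nonneg_left hE1 (mul_nonneg hr0 hη)
  have hcore : ∀ (e m : ℕ) (s η : ℝ), 0 ≤ η → 2 ^ e + m < i → s ≤ 2 * 2 ^ e →
      (∀ a : Fin n, m ≤ a → Sloppy.initEigenvalue α σw T (Real.exp (-(a : ℝ) * c)) ≤
        σw ^ 2 / (α * T) * η) →
      Sloppy.eig hP i hi / E ≤ 4 * ρ ^ (-s) + r * η := by
    intro e m s η hη hem hs hGa
    have h := Sloppy.eig_P1_le_of_sloppy hn hU hU' hKU hc hα0 hα1 hP hE0.le e m hGa i hi hem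
    have h2 : Sloppy.eig hP i hi / E ≤
        4 * Real.exp (-(2 * 2 ^ e * Λ)) + (σw ^ 2 / (α * T) * η) / E := by
      rw [div_le_iff₀ hE0, add_mul, div_mul_cancel₀ _ hE0.ne']
      exact h
    refine h2.trans (add_le_add ?_ (hG η _ hη le_rfl))
    rw [hρ]
    refine mul_le_mul_of_nonneg_left (Real.exp_le_exp.mpr ?_) (by norm_num)
    nlinarith
  -- The whole budget `i - 1` goes to zeros and no eigenvector of `K` is removed.
  have hfull : Sloppy.eig hP i hi / E ≤ 4 * ρ ^ (-((i : ℝ) - 1)) + r := by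
    rcases Nat.lt_or_ge i 2 with h | h
    · have hi1 : (i : ℝ) = 1 := by exact_mod_cast (by omega : i = 1)
      rw [hi1, hρ, sub_self, neg_zero, mul_zero, Real.exp_zero]
      linarith
    · obtain ⟨e, he1, he2⟩ := Sloppy.exists_two_pow_le_lt (d := i - 1) (by omega)
      have := hcore e 0 ((i : ℝ) - 1) 1 zero_le_one (by omega) ?_ ?_
      · rwa [mul_one] at this
      · have : ((i - 1 + 1 : ℕ) : ℝ) ≤ ((2 * 2 ^ e : ℕ) : ℝ) := by exact_mod_cast he2
        rw [Nat.sub_add_cancel hi.1] at this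
        push_cast at this
        linarith
      · intro a _
        rw [mul_one]
        exact Sloppy.initEigenvalue_le_div hα0 (hμ1 a) (hμ0 a).le
  refine ⟨fun _ => le_min hle1 hfull, fun hik => ?_⟩
  have hη0 : 0 ≤ min 1 (2 * α * (T : ℝ) * Sloppy.sloppy c ((i : ℝ) - k + 1)) :=
    le_min zero_le_one (by unfold Sloppy.sloppy; positivity)
  have htriv : 1 ≤ 4 * ρ ^ (-(k - 1)) → Sloppy.eig hP i hi / E ≤ 4 * ρ ^ (-(k - 1)) +
      r * min 1 (2 * α * (T : ℝ) * Sloppy.sloppy c ((i : ℝ) - k + 1)) := fun h => by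
    have := mul_nonneg hr0 hη0
    linarith
  rcases le_or_gt k 1 with hk1 | hk1
  · refine htriv ?_
    rw [hρ]
    have := Real.one_le_exp (x := Λ * -(k - 1)) (by nlinarith)
    linarith
  have hin : (i : ℝ) ≤ n := by exact_mod_cast hi.2
  -- If `k` were `n / 2`, then `2 k < i ≤ n` would fail.
  have hk : k = Real.log (2 * (T : ℝ) * α) / (2 * c) := by
    have h : k = min (Real.log (2 * (T : ℝ) * α) / (2 * c)) ((n : ℝ) / 2) := rfl
    rcases min_choice (Real.log (2 * (T : ℝ) * α) / (2 * c)) ((n : ℝ) / 2) with h' | h'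
    · rw [h, h']
    · rw [h'] at h; linarith
  have hTα : 2 * α * (T : ℝ) = Real.exp (2 * k * c) := by
    rw [hk]
    have : 2 * (Real.log (2 * (T : ℝ) * α) / (2 * c)) * c = Real.log (2 * (T : ℝ) * α) := by
      field_simp
    rw [this, Real.exp_log (by positivity)]
    ring
  have hη : 2 * α * (T : ℝ) * Sloppy.sloppy c ((i : ℝ) - k + 1) =
      Real.exp ((3 * k - i) * c) := by
    rw [hTα, Sloppy.sloppy, ← Real.exp_add]
    congr 1
    ring
  -- When the minimum is `1`, `hfull` is enough because `k < i`; otherwise `i > 3 k`.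
  rcases le_or_gt 1 (2 * α * (T : ℝ) * Sloppy.sloppy c ((i : ℝ) - k + 1)) with h1 | h1
  · rw [min_eq_left h1, mul_one]
    refine hfull.trans (add_le_add_left (mul_le_mul_of_nonneg_left ?_ (by norm_num)) r)
    rw [hρ, hρ, Real.exp_le_exp]
    nlinarith
  have hik3 : 3 * k < i := by
    rw [hη, ← Real.exp_zero, Real.exp_lt_exp] at h1
    by_contra h
    nlinarith
  rw [min_eq_right h1.le]
  rw [min_eq_right h1.le] at hη0 htriv
  have hinit : ∀ a : Fin n, Real.exp (-(a : ℝ) * c) ≤ 2 * Real.exp (-(i - k) * c) →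
      Sloppy.initEigenvalue α σw T (Real.exp (-(a : ℝ) * c)) ≤
        σw ^ 2 / (α * T) * (2 * α * (T : ℝ) * Sloppy.sloppy c ((i : ℝ) - k + 1)) := by
    intro a ha
    refine (Sloppy.initEigenvalue_le_mul hT hα0.le (hμ1 a) (hμ0 a).le).trans ?_
    have e : Sloppy.sloppy c ((i : ℝ) - k + 1) = Real.exp (-(i - k) * c) := by
      rw [Sloppy.sloppy]; congr 1; ring
    rw [e]
    calc _ ≤ σw ^ 2 * (2 * Real.exp (-(i - k) * c)) :=
          mul_le_mul_of_nonneg_left ha (sq_nonneg _)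
      _ = _ := by field_simp
  rcases le_or_gt 2 k with hk2 | hk2
  · have hk0 : (0 : ℝ) ≤ k := by linarith
    have hj1 := Nat.floor_le hk0
    have hj2 := Nat.lt_floor_add_one k
    set j := ⌊k⌋₊
    have hj : 2 ≤ j := Nat.le_floor (by exact_mod_cast hk2)
    have hji : j < i := by
      have : (j : ℝ) < i := by linarith
      exact_mod_cast this
    obtain ⟨e, he1, he2⟩ := Sloppy.exists_two_pow_le_lt (d := j - 1) (by omega)
    -- At most `j - 1` zeros and `i - j` eigenvectors stay within the budget `i - 1`; `j ≤ k` gives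
    -- the required decay `a ≥ i - k`.
    refine hcore e (i - j) (k - 1) _ hη0 (by omega) ?_ fun a ha => hinit a ?_
    · have : ((j - 1 + 1 : ℕ) : ℝ) ≤ ((2 * 2 ^ e : ℕ) : ℝ) := by exact_mod_cast he2
      rw [Nat.sub_add_cancel (by omega)] at this
      push_cast at this
      linarith
    · have hx : Real.exp (-(a : ℝ) * c) ≤ Real.exp (-(i - k) * c) := by
        rw [Real.exp_le_exp]
        have hia : (i : ℝ) ≤ (a : ℕ) + j := by exact_mod_cast (by omega : i ≤ (a : ℕ) + j)
        exact mul_le_mul_of_nonneg_right (by linarith) hc.le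
      linarith [Real.exp_pos (-(i - k) * c)]
  · have hi4 : 4 ≤ i := by
      have : (3 : ℝ) < i := by linarith
      have : 3 < i := by exact_mod_cast this
      omega
    -- For `1 < k < 2` the budget split by `⌊k⌋` would leave no zero. If `c ≥ log 2`, then `n ≥ 4`
    -- gives `λ₁ / λ_n ≥ 8`, so `ρ ≤ 4` and the claimed bound is at least `1`.
    rcases le_or_gt (Real.log 2) c with hc2 | hc2
    · refine htriv ?_
      have hx : 8 ≤ 1 / Real.exp (-((n : ℝ) - 1) * c) := by
        have h4 : (4 : ℝ) ≤ n := by exact_mod_cast hi4.trans hi.2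
        have h8 : Real.exp (3 * Real.log 2) = 8 := by
          rw [mul_comm, Real.exp_mul, Real.exp_log two_pos]; norm_num
        rw [← h8, one_div, ← Real.exp_neg, Real.exp_le_exp]
        have h3c : 3 * c ≤ ((n : ℝ) - 1) * c := mul_le_mul_of_nonneg_right (by linarith) hc.le
        linarith
      have hΛ4 := Sloppy.pi_sq_div_log_le hx
      rw [← mul_div_assoc, ← hΛ] at hΛ4
      have h4 : Real.exp (-Real.log 4) = 1 / 4 := by
        rw [Real.exp_neg, Real.exp_log (by norm_num)]; norm_num
      have : Real.exp (-Real.log 4) ≤ ρ ^ (-(k - 1)) := by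
        rw [hρ, Real.exp_le_exp]
        have := mul_le_mul_of_nonneg_left (by linarith : k - 1 ≤ 1) hΛ0
        linarith
      linarith
    -- One zero and `i - 2` eigenvectors. Falling short of index `i - k` by `2 - k < 1` costs a
    -- factor below `exp c < 2`, absorbed by the `2` in `2 α T`.
    · refine hcore 0 (i - 2) (k - 1) _ hη0 (by omega) (by norm_num; linarith)
        fun a ha => hinit a ?_
      have e : 2 * Real.exp (-(i - k) * c) = Real.exp (Real.log 2 + -(i - k) * c) := by
        rw [Real.exp_add, Real.exp_log two_pos]
      rw [e, Real.exp_le_exp]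
      have hia : (i : ℝ) ≤ (a : ℕ) + 2 := by exact_mod_cast (by omega : i ≤ (a : ℕ) + 2)
      have h2k : ((i : ℝ) - k - (a : ℕ)) * c ≤ 1 * c :=
        mul_le_mul_of_nonneg_right (by linarith) hc.le
      linarith
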